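/- A group $G$ is *hyperbolic* if it has a finite generating set $S=S^{-1}$ and a constant $\delta\ge 0$ such that in the Cayley graph $X(G,S)$ with the word metric every geodesic triangle is $\delta$-thin, i.e. each side lies in the $\delta$-neighbourhood of the union of the other two sides. A group $G$ is *conjugacy separable* if any two elements of $G$ whose images are conjugate in every finite quotient of $G$ are conjugate in $G$. Write $\mathrm{Out}(G)=\mathrm{Aut}(G)/\mathrm{Inn}(G)$. **Theorem.** Let $G$ be a conjugacy separable hyperbolic group. Then every virtually torsion-free subgroup of $\mathrm{Out}(G)$ (that is, every subgroup that has a torsion-free subgroup of finite index) is residually finite. -/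

import Mathlib

namespace HypGroup

/-- A walk in a graph is geodesic if its length is the graph distance of its end points. -/
def IsGeodesic {V : Type*} {Γ : SimpleGraph V} {u v : V} (p : Γ.Walk u v) : Prop :=
  p.length = Γ.dist u v

/-- A graph is `δ`-hyperbolic if every geodesic triangle is `δ`-thin: each side is contained in
the `δ`-neighbourhood of the union of the two other sides. As the three vertices and the three
sides are arbitrary (and walks can be reversed), it suffices to speak about one side `p`.
The triangles are those with corners at vertices of the graph and edge paths as sides. They are
among the geodesic triangles of the realization of the graph as a metric space, so that the
condition here is implied by the one for the realization (with `δ + 1` in place of `δ`); it is in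
fact equivalent to it up to a change of `δ`, since a geodesic of the realization follows an edge
path except on a piece of length less than `1` at either end. -/
def IsHyperbolicGraph {V : Type*} (Γ : SimpleGraph V) (δ : ℝ) : Prop :=
  ∀ (x y z : V) (p : Γ.Walk x y) (q : Γ.Walk y z) (r : Γ.Walk x z),
    IsGeodesic p → IsGeodesic q → IsGeodesic r →
      ∀ a ∈ p.support, ∃ b, (b ∈ q.support ∨ b ∈ r.support) ∧ (Γ.dist a b : ℝ) ≤ δ

/-- A group is hyperbolic if it has a finite generating set `S`, closed under inverses, such that
its Cayley graph with respect to `S` is `δ`-hyperbolic for some `δ ≥ 0`. The graph distance of the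
Cayley graph is the word metric. -/
def IsHyperbolic (G : Type*) [Group G] : Prop :=
  ∃ S : Set G, S.Finite ∧ (∀ s ∈ S, s⁻¹ ∈ S) ∧ Subgroup.closure S = ⊤ ∧
    ∃ δ : ℝ, 0 ≤ δ ∧ IsHyperbolicGraph (SimpleGraph.mulCayley S) δ

/-- A group is conjugacy separable if any two elements whose images are conjugate in every finite
quotient of the group are conjugate in the group. -/
def IsConjugacySeparable (G : Type*) [Group G] : Prop :=
  ∀ g h : G,
    (∀ (N : Subgroup G) [N.Normal], N.FiniteIndex → IsConj (g : G ⧸ N) (h : G ⧸ N)) → IsConj g h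

/-- A group is torsion-free if its only element of finite order is the identity. (For groups that
need not be commutative, Mathlib's `IsMulTorsionFree`, which asks for unique roots, is stronger.) -/
def IsTorsionFreeGroup (G : Type*) [Group G] : Prop :=
  ∀ g : G, IsOfFinOrder g → g = 1

/-- A group is virtually torsion-free if it has a torsion-free subgroup of finite index. -/
def IsVirtuallyTorsionFree (G : Type*) [Group G] : Prop :=
  ∃ K : Subgroup G, K.FiniteIndex ∧ IsTorsionFreeGroup K

/-- The group `Inn(G)` of inner automorphisms of `G`. -/
def Inn (G : Type*) [Group G] : Subgroup (MulAut G) :=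
  (MulAut.conj : G →* MulAut G).range

instance Inn.normal (G : Type*) [Group G] : (Inn G).Normal where
  conj_mem := by
    rintro _ ⟨g, rfl⟩ f
    refine ⟨f g, ?_⟩
    ext x
    simp [MulAut.mul_apply]

/-- The outer automorphism group `Out(G) = Aut(G) / Inn(G)`. -/
abbrev Out (G : Type*) [Group G] : Type _ :=
  MulAut G ⧸ Inn G

end HypGroup

/-! Pointwise inner automorphisms of a hyperbolic group have only finitely many outer classes. For
such `φ` and generators `s`, `t`, the elements `φ s` and `φ (s * t)` are conjugates of words of
length at most 2, so each almost fixes some point. Hyperbolicity yields one point almost fixed by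
all `φ s` (`exists_forall_dist_le`), and an inner correction then makes `φ` send generators into a
fixed finite ball. Powers stay pointwise inner, so these classes are torsion.

Hence a nontrivial element of the torsion-free `K` is not pointwise inner. Conjugacy separability
detects this in a finite quotient of `G`, and the automorphisms preserving the quotient map up to
conjugation form a finite-index subgroup that excludes it. Elements outside `K` are excluded by `K`.
-/

namespace HypGroup

/-! ### Thin triangles imply the four-point inequality. -/

section FourPoint

variable {V : Type*} {Γ : SimpleGraph V} {u v w x y z : V}

theorem IsGeodesic.dist_add_dist {p : Γ.Walk u v} (hp : IsGeodesic p) (hΓ : Γ.Connected)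
    (hw : w ∈ p.support) : Γ.dist u w + Γ.dist w v = Γ.dist u v := by
  classical
  have h1 := Γ.dist_le (p.takeUntil w hw)
  have h2 := Γ.dist_le (p.dropUntil w hw)
  have h3 := congrArg SimpleGraph.Walk.length (p.take_spec hw)
  rw [SimpleGraph.Walk.length_append] at h3
  have h4 := hΓ.dist_triangle (u := u) (v := w) (w := v)
  unfold IsGeodesic at hp
  omega

/-- A walk leading from a point satisfying `P` to a point satisfying `Q`, all of whose vertices
satisfy `P` or `Q`, passes from a vertex with `P` to a vertex with `Q` in at most one step. -/
theorem exists_mem_support_transition (P Q : V → Prop) (p : Γ.Walk u v) (hu : P u) (hv : Q v)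
    (h : ∀ a ∈ p.support, P a ∨ Q a) :
    ∃ a ∈ p.support, ∃ b ∈ p.support, P a ∧ Q b ∧ Γ.dist a b ≤ 1 := by
  induction p with
  | nil => exact ⟨_, by simp, _, by simp, hu, hv, by simp⟩
  | @cons a b c hab p ih =>
    rcases h b (by simp) with hb | hb
    · obtain ⟨s, hs, t, ht, h1, h2, h3⟩ := ih hb hv fun d hd => h d (by simp [hd])
      exact ⟨s, by simp [hs], t, by simp [ht], h1, h2, h3⟩
    · exact ⟨a, by simp, b, by simp, hu, hb, (SimpleGraph.dist_eq_one_iff_adj.2 hab).le⟩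

/-- A geodesic comes as close to a point as the Gromov product predicts. -/
theorem IsHyperbolicGraph.exists_mem_support_dist_le {k : ℕ} (hΓ : Γ.Connected)
    (hk : IsHyperbolicGraph Γ k) {p : Γ.Walk x y} (hp : IsGeodesic p) (z : V) :
    ∃ w ∈ p.support, Γ.dist x y + 2 * Γ.dist z w ≤ Γ.dist x z + Γ.dist y z + 4 * k + 2 := by
  obtain ⟨q, hq⟩ := hΓ.exists_walk_length_eq_dist y z
  obtain ⟨r, hr⟩ := hΓ.exists_walk_length_eq_dist x z
  have hthin := hk x y z p q r hp hq hr
  obtain ⟨a, ha, b, -, ⟨s, hs, has⟩, ⟨t, ht, hbt⟩, hab⟩ :=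
    exists_mem_support_transition (fun a => ∃ s ∈ r.support, Γ.dist a s ≤ k)
      (fun a => ∃ s ∈ q.support, Γ.dist a s ≤ k) p ⟨x, by simp, by simp⟩ ⟨y, by simp, by simp⟩
      (fun a ha => by
        obtain ⟨b, hb | hb, hd⟩ := hthin a ha
        · exact Or.inr ⟨b, hb, by exact_mod_cast hd⟩
        · exact Or.inl ⟨b, hb, by exact_mod_cast hd⟩)
  -- The detour through `s` costs `2 * k`, the one through `t` costs `2 * (k + 1)`.
  refine ⟨a, ha, ?_⟩
  have e1 := IsGeodesic.dist_add_dist hp hΓ ha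
  have e2 := IsGeodesic.dist_add_dist hr hΓ hs
  have e3 := IsGeodesic.dist_add_dist hq hΓ ht
  have t1 := hΓ.dist_triangle (u := x) (v := s) (w := a)
  have t2 := hΓ.dist_triangle (u := a) (v := s) (w := z)
  have t3 := hΓ.dist_triangle (u := y) (v := t) (w := a)
  have t4 := hΓ.dist_triangle (u := a) (v := t) (w := z)
  have t5 := hΓ.dist_triangle (u := a) (v := b) (w := t)
  rw [Γ.dist_comm (u := s) (v := a)] at t1
  rw [Γ.dist_comm (u := t) (v := a)] at t3
  rw [Γ.dist_comm (u := a) (v := y)] at e1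
  rw [Γ.dist_comm (u := z) (v := a)]
  omega

/-- Gromov's four-point inequality in a graph with thin triangles. -/
theorem IsHyperbolicGraph.four_point {k : ℕ} (hΓ : Γ.Connected) (hk : IsHyperbolicGraph Γ k)
    (x y z w : V) :
    Γ.dist x y + Γ.dist z w ≤ Γ.dist x z + Γ.dist y w + (6 * k + 2) ∨
      Γ.dist x y + Γ.dist z w ≤ Γ.dist x w + Γ.dist y z + (6 * k + 2) := by
  obtain ⟨p, hp⟩ := hΓ.exists_walk_length_eq_dist x y
  obtain ⟨q, hq⟩ := hΓ.exists_walk_length_eq_dist y z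
  obtain ⟨r, hr⟩ := hΓ.exists_walk_length_eq_dist x z
  obtain ⟨u, hu, hd⟩ := hk.exists_mem_support_dist_le hΓ hp w
  obtain ⟨v, hv, huv⟩ := hk x y z p q r hp hq hr u hu
  have huv : Γ.dist u v ≤ k := by exact_mod_cast huv
  have t0 := hΓ.dist_triangle (u := w) (v := u) (w := v)
  have t3 := hΓ.dist_triangle (u := z) (v := v) (w := w)
  rw [Γ.dist_comm (u := v) (v := w), Γ.dist_comm (u := z) (v := v)] at t3
  rcases hv with hv | hv
  · have e := IsGeodesic.dist_add_dist hq hΓ hv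
    have t1 := hΓ.dist_triangle (u := y) (v := v) (w := w)
    rw [Γ.dist_comm (u := v) (v := w)] at t1
    right; omega
  · have e := IsGeodesic.dist_add_dist hr hΓ hv
    have t1 := hΓ.dist_triangle (u := x) (v := v) (w := w)
    rw [Γ.dist_comm (u := v) (v := w)] at t1
    left; omega

theorem exists_dist_eq (hΓ : Γ.Connected) {k : ℕ} (hk : k ≤ Γ.dist x y) :
    ∃ m, Γ.dist x m = k ∧ Γ.dist m y + k = Γ.dist x y := by
  obtain ⟨p, hp⟩ := hΓ.exists_walk_length_eq_dist x y
  have h1 := Γ.dist_le (p.take k)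
  have h2 := Γ.dist_le (p.drop k)
  have h3 := hΓ.dist_triangle (u := x) (v := p.getVert k) (w := y)
  rw [SimpleGraph.Walk.take_length] at h1
  rw [SimpleGraph.Walk.drop_length] at h2
  exact ⟨p.getVert k, by omega, by omega⟩

end FourPoint

/-! ### Common almost fixed points. -/

/-- An integer-valued left-invariant geodesic pseudometric on a group with the four-point inequality for
the constant `c`. -/
structure IsHyperbolicMetric {G : Type*} [Group G] (d : G → G → ℕ) (c : ℕ) : Prop where
  self : ∀ x, d x x = 0
  comm : ∀ x y, d x y = d y x
  triangle : ∀ x y z, d x z ≤ d x y + d y z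
  mul_left : ∀ g x y, d (g * x) (g * y) = d x y
  geodesic : ∀ x y k, k ≤ d x y → ∃ m, d x m = k ∧ d m y + k = d x y
  four_point : ∀ x y z w,
    d x y + d z w ≤ d x z + d y w + c ∨ d x y + d z w ≤ d x w + d y z + c

namespace IsHyperbolicMetric

variable {G : Type*} [Group G] {d : G → G → ℕ} {c C K : ℕ} {a b x m p : G}

theorem inv_left (hd : IsHyperbolicMetric d c) (a x y : G) : d (a⁻¹ * x) y = d x (a * y) := by
  rw [← hd.mul_left a, mul_inv_cancel_left]

/-- An element that moves some point by at most `C` has small translation length at any point. -/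
theorem dist_sq_le (hd : IsHyperbolicMetric d c) (hp : d p (a * p) ≤ C) (x : G) :
    d x (a * (a * x)) ≤ d x (a * x) + 3 * C + c := by
  have h := hd.four_point x (a * (a * x)) (a * x) p
  have e1 := hd.mul_left a x (a * x)
  have e2 := hd.mul_left a x p
  have e3 := hd.mul_left a (a * x) (a * p)
  have e4 := hd.mul_left a p (a * p)
  have t1 := hd.triangle (a * (a * x)) (a * (a * p)) p
  have t2 := hd.triangle (a * (a * p)) (a * p) p
  have t3 := hd.triangle (a * x) p (a * p)
  rw [hd.comm (a * (a * p)) (a * p), hd.comm (a * p) p] at t2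
  rw [hd.comm (a * (a * x)) (a * x)] at h
  omega

/-- If `a`, `b` and `a * b` almost fix points, then the paths from `x` to its translates under
`a` and `b` start in the same direction. -/
theorem dist_add_le_of_almost_fixed (hd : IsHyperbolicMetric d c) (ha : d p (a * p) ≤ C)
    (hb : ∃ q, d q (b * q) ≤ C) (hab : ∃ q, d q (a * b * q) ≤ C)
    (hA : 6 * K + 6 * c + 3 * C ≤ d x (a * x)) (hB : 6 * K + 6 * c + 3 * C ≤ d x (b * x)) :
    d (a * x) (b * x) + 2 * K ≤ d x (a * x) + d x (b * x) := by
  obtain ⟨q, hb⟩ := hb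
  obtain ⟨r, hab⟩ := hab
  have sa := hd.dist_sq_le ha x
  have sb := hd.dist_sq_le hb x
  have sab := hd.dist_sq_le hab x
  -- If the claim failed, `g1` and `g2` would put `a * b * x` and `b * a * x` at distance about `d x
  -- (a * x) + d x (b * x)` from `x`: by `sa` and `sb`, inverses move `x` in nearly the same
  -- direction. Then `f1` and `f2` make the displacement of `(a * b)²` about twice that of `a * b`,
  -- against `sab`.
  have g1 := hd.four_point (a * x) (b * x) x (a⁻¹ * x)
  have g2 := hd.four_point (b * x) (a * x) x (b⁻¹ * x)
  rw [hd.comm _ (a⁻¹ * x), hd.comm _ (a⁻¹ * x), hd.comm _ (a⁻¹ * x), hd.inv_left, hd.inv_left,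
    hd.inv_left, hd.comm (a * x) x, hd.comm (b * x) x] at g1
  rw [hd.comm _ (b⁻¹ * x), hd.comm _ (b⁻¹ * x), hd.comm _ (b⁻¹ * x), hd.inv_left, hd.inv_left,
    hd.inv_left, hd.comm (a * x) x, hd.comm (b * x) x, hd.comm (b * x) (a * x)] at g2
  simp only [mul_assoc] at sab
  have f1 := hd.four_point x (a * (b * x)) (a * x) (a * (b * (a * x)))
  have f2 := hd.four_point x (a * (b * (a * x))) (a * (b * x)) (a * (b * (a * (b * x))))
  simp only [hd.mul_left] at f1 f2
  rw [hd.comm (b * x) x] at f1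
  rw [hd.comm (a * x) x] at f2
  omega

/-- Moving `x` in the direction of `b * x` decreases the displacement under `b`. -/
theorem dist_mul_lt (hd : IsHyperbolicMetric d c) (hp : d p (b * p) ≤ C) {y : G}
    (hK : 2 * c < K) (hm : d x m = K) (hmy : d m y + K = d x y) (hB : 3 * K + 3 * C ≤ d x (b * x))
    (hg : d y (b * x) + 2 * K ≤ d x y + d x (b * x)) : d m (b * m) < d x (b * x) := by
  have s := hd.dist_sq_le hp x
  -- `h1` and `h2` bring `m` and `b * m` closer to `b * x` and `x` by `K`, up to `c` and `2 * c`. So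
  -- `h3` saves `2 * K - 4 * c > 0`.
  have h1 := hd.four_point m (b * x) x y
  have h2 := hd.four_point m (b⁻¹ * x) x (b * x)
  have h3 := hd.four_point m (b * m) x (b * x)
  rw [hd.comm m x, hd.comm (b * x) y, hd.comm (b * x) x] at h1
  rw [hd.comm m (b⁻¹ * x), hd.inv_left, hd.inv_left, hd.inv_left, hd.comm m x] at h2
  rw [hd.mul_left, hd.comm m x, hd.comm (b * m) x] at h3
  omega

/-- A finite set of elements which together with their pairwise products almost fix points has an
almost fixed point. -/
theorem exists_forall_dist_le (hd : IsHyperbolicMetric d c) (T : Finset G)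
    (hT : ∀ a ∈ T, ∃ q, d q (a * q) ≤ C) (hTT : ∀ a ∈ T, ∀ b ∈ T, ∃ q, d q (a * b * q) ≤ C) :
    ∃ x, ∀ a ∈ T, d x (a * x) ≤ 100 * (c + C + 1) := by
  set f : G → ℕ := fun x => T.sup fun a => d x (a * x) with hf
  -- Minimize the largest displacement; if it is too big, a step of length `2 * c + 1` towards `a *
  -- x`, with `a` of maximal displacement, lowers every displacement below the maximum.
  obtain ⟨x, -, hx⟩ := (measure f).wf.has_min Set.univ ⟨1, trivial⟩
  replace hx : ∀ y, f x ≤ f y := fun y => not_lt.1 (hx y trivial)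
  have hle : ∀ a ∈ T, d x (a * x) ≤ f x := fun a ha =>
    Finset.le_sup (f := fun a => d x (a * x)) ha
  refine ⟨x, fun a ha => (hle a ha).trans ?_⟩
  by_contra! hlt
  obtain ⟨a, ha, hfa⟩ := Finset.exists_mem_eq_sup T ⟨a, ha⟩ fun a => d x (a * x)
  change f x = d x (a * x) at hfa
  obtain ⟨m, hm, hma⟩ := hd.geodesic x (a * x) (2 * c + 1) (by omega)
  refine (hx m).not_gt ((Finset.sup_lt_iff (by simp; omega)).2 fun b hb => ?_)
  have hb' := hle b hb
  by_cases hB : d x (b * x) + 2 * (2 * c + 1) < f x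
  · have t1 := hd.triangle m x (b * m)
    have t2 := hd.triangle x (b * x) (b * m)
    rw [hd.mul_left] at t2
    rw [hd.comm m x] at t1
    omega
  · obtain ⟨p, hp⟩ := hT a ha
    obtain ⟨q, hq⟩ := hT b hb
    have hg := hd.dist_add_le_of_almost_fixed (K := 2 * c + 1) (x := x) hp ⟨q, hq⟩ (hTT a ha b hb)
      (by omega) (by omega)
    exact (hd.dist_mul_lt hq (by omega) hm hma (by omega) hg).trans_le hb'

end IsHyperbolicMetric

/-! ### The word metric. -/

section Cayley

variable {G : Type*} [Group G] {S : Set G}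

theorem mulCayley_connected (hS : Subgroup.closure S = ⊤) :
    (SimpleGraph.mulCayley S).Connected := by
  have hstep : ∀ x : G, ∀ s ∈ S, (SimpleGraph.mulCayley S).Reachable x (x * s) := fun x s hs => by
    by_cases h : x = x * s
    · rw [← h]
    · exact SimpleGraph.Adj.reachable ((SimpleGraph.mulCayley_adj' _ _ _).2 ⟨h, s, hs, Or.inl rfl⟩)
  have key : ∀ g : G, ∀ x, (SimpleGraph.mulCayley S).Reachable x (x * g) := fun g => by
    have hg : g ∈ Subgroup.closure S := hS ▸ Subgroup.mem_top g
    induction hg using Subgroup.closure_induction with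
    | mem s hs => exact fun x => hstep x s hs
    | one => intro x; rw [mul_one]
    | mul g h _ _ hg hh => intro x; rw [← mul_assoc]; exact (hg x).trans (hh _)
    | inv g _ hg => intro x; simpa using (hg (x * g⁻¹)).symm
  exact ⟨fun x y => by simpa using key (x⁻¹ * y) x⟩

theorem mulCayley_dist_mul_left_le (hS : Subgroup.closure S = ⊤) (g x y : G) :
    (SimpleGraph.mulCayley S).dist (g * x) (g * y) ≤ (SimpleGraph.mulCayley S).dist x y := by
  obtain ⟨p, hp⟩ := (mulCayley_connected hS).exists_walk_length_eq_dist x y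
  let f : SimpleGraph.mulCayley S →g SimpleGraph.mulCayley S :=
    ⟨fun z => g * z, fun h => SimpleGraph.mulCayley_adj_mul_iff_right.2 h⟩
  exact (SimpleGraph.dist_le (p.map f)).trans (by rw [SimpleGraph.Walk.length_map, hp])

theorem mulCayley_dist_mul_left (hS : Subgroup.closure S = ⊤) (g x y : G) :
    (SimpleGraph.mulCayley S).dist (g * x) (g * y) = (SimpleGraph.mulCayley S).dist x y := by
  refine (mulCayley_dist_mul_left_le hS g x y).antisymm ?_
  simpa using mulCayley_dist_mul_left_le hS g⁻¹ (g * x) (g * y)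

theorem mulCayley_dist_mul_right_le (x : G) {s : G} (hs : s ∈ S) :
    (SimpleGraph.mulCayley S).dist x (x * s) ≤ 1 := by
  by_cases h : x = x * s
  · rw [← h, SimpleGraph.dist_self]; exact zero_le_one
  · exact (SimpleGraph.dist_eq_one_iff_adj.2
      ((SimpleGraph.mulCayley_adj' _ _ _).2 ⟨h, s, hs, Or.inl rfl⟩)).le

theorem exists_list_prod_of_walk (hinv : ∀ s ∈ S, s⁻¹ ∈ S) {x y : G}
    (p : (SimpleGraph.mulCayley S).Walk x y) : ∃ l : List G,
      l.length = p.length ∧ (∀ s ∈ l, s ∈ S) ∧ x * l.prod = y := by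
  induction p with
  | nil => exact ⟨[], by simp⟩
  | @cons a b c hab p ih =>
    obtain ⟨l, h1, h2, h3⟩ := ih
    obtain ⟨-, h⟩ := (SimpleGraph.mulCayley_adj _ _ _).1 hab
    have hs : a⁻¹ * b ∈ S := h.elim id fun h => by simpa using hinv _ h
    refine ⟨(a⁻¹ * b) :: l, by simp [h1], by simpa [hs] using h2, by simp [← mul_assoc, h3]⟩

theorem finite_mulCayley_ball (hS : S.Finite) (hinv : ∀ s ∈ S, s⁻¹ ∈ S)
    (hgen : Subgroup.closure S = ⊤) (n : ℕ) :
    {g : G | (SimpleGraph.mulCayley S).dist 1 g ≤ n}.Finite := by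
  have : Finite S := hS
  refine (((List.finite_length_le S n).image fun l => (l.map Subtype.val).prod)).subset
    fun g hg => ?_
  obtain ⟨p, hp⟩ := (mulCayley_connected hgen).exists_walk_length_eq_dist 1 g
  obtain ⟨l, h1, h2, h3⟩ := exists_list_prod_of_walk hinv p
  lift l to List S using h2
  refine ⟨l, ?_, by simpa using h3⟩
  simp only [List.length_map] at h1
  exact (h1.trans hp).trans_le hg

theorem IsHyperbolicGraph.isHyperbolicMetric {k : ℕ} (hgen : Subgroup.closure S = ⊤)
    (hk : IsHyperbolicGraph (SimpleGraph.mulCayley S) k) :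
    IsHyperbolicMetric (SimpleGraph.mulCayley S).dist (6 * k + 2) where
  self _ := SimpleGraph.dist_self
  comm _ _ := SimpleGraph.dist_comm
  triangle _ _ _ := (mulCayley_connected hgen).dist_triangle
  mul_left := mulCayley_dist_mul_left hgen
  geodesic _ _ _ := exists_dist_eq (mulCayley_connected hgen)
  four_point := hk.four_point (mulCayley_connected hgen)

end Cayley

/-! ### Pointwise inner automorphisms and finite quotients of `Out G`. -/

section Automorphisms

variable {G : Type*} [Group G]

/-- An automorphism is pointwise inner if it preserves all conjugacy classes. -/
def IsPointwiseInner (φ : MulAut G) : Prop :=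
  ∀ g, IsConj g (φ g)

theorem IsPointwiseInner.pow {φ : MulAut G} (hφ : IsPointwiseInner φ) (n : ℕ) :
    IsPointwiseInner (φ ^ n) := by
  induction n with
  | zero => exact fun g => IsConj.refl g
  | succ n ih =>
    intro g
    rw [pow_succ, MulAut.mul_apply]
    exact (hφ g).trans (ih (φ g))

theorem injective_restrict_generators {Q : Type*} [Group Q] {S : Set G} (hS : Subgroup.closure S = ⊤) :
    Function.Injective fun (f : G →* Q) (s : S) => f s := fun _ _ h =>
  MonoidHom.eq_of_eqOn_dense hS fun s hs => congrFun h ⟨s, hs⟩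

/-- The pointwise inner automorphisms of a hyperbolic group have finite image in the outer
automorphism group. -/
theorem IsHyperbolic.finite_image_isPointwiseInner (hG : IsHyperbolic G) :
    ((QuotientGroup.mk : MulAut G → Out G) '' {φ | IsPointwiseInner φ}).Finite := by
  classical
  obtain ⟨S, hS, hinv, hgen, δ, -, hδ⟩ := hG
  have hk : IsHyperbolicGraph (SimpleGraph.mulCayley S) (⌈δ⌉₊ : ℕ) := fun x y z p q r hp hq hr a
      ha =>
    (hδ x y z p q r hp hq hr a ha).imp fun _ h => ⟨h.1, h.2.trans (Nat.le_ceil δ)⟩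
  have hd := hk.isHyperbolicMetric hgen
  set c := 6 * ⌈δ⌉₊ + 2
  set d := (SimpleGraph.mulCayley S).dist
  have hball := finite_mulCayley_ball hS hinv hgen (100 * (c + 2 + 1))
  have : Finite S := hS
  have hF : {φ : MulAut G | ∀ s ∈ S, d 1 (φ s) ≤ 100 * (c + 2 + 1)}.Finite := by
    refine Set.Finite.of_finite_image
      (f := fun (φ : MulAut G) (s : S) => φ s)
      ((Set.Finite.pi' fun _ : S => hball).subset ?_) ?_
    · rintro _ ⟨φ, hφ, rfl⟩ s
      exact hφ s s.2
    · intro φ _ ψ _ h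
      exact MulEquiv.toMonoidHom_injective
        (injective_restrict_generators hgen (show (fun s : S => φ.toMonoidHom s) = _ from h))
  refine (hF.image QuotientGroup.mk).subset ?_
  rintro _ ⟨φ, hφ, rfl⟩
  have key : ∀ g, ∃ q, d q (φ g * q) ≤ d 1 g := fun g => by
    obtain ⟨q, hq⟩ := isConj_iff.1 (hφ g)
    refine ⟨q, ?_⟩
    rw [← hq, inv_mul_cancel_right, ← hd.mul_left q 1 g, mul_one]
  have h1 : ∀ s ∈ S, d 1 s ≤ 1 := fun s hs => by
    simpa using mulCayley_dist_mul_right_le 1 hs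
  obtain ⟨x, hx⟩ := hd.exists_forall_dist_le (C := 2) (hS.toFinset.image φ)
    (by
      simp only [Finset.mem_image, Set.Finite.mem_toFinset]
      rintro _ ⟨s, hs, rfl⟩
      exact (key s).imp fun q hq => hq.trans ((h1 s hs).trans one_le_two))
    (by
      simp only [Finset.mem_image, Set.Finite.mem_toFinset]
      rintro _ ⟨s, hs, rfl⟩ _ ⟨t, ht, rfl⟩
      rw [← map_mul]
      exact (key (s * t)).imp fun q hq => hq.trans ((hd.triangle 1 s (s * t)).trans
        (Nat.add_le_add (h1 s hs) (mulCayley_dist_mul_right_le s ht))))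
  -- Conjugation by `x⁻¹` carries the almost fixed point `x` to `1`, turning displacement into word
  -- length.
  refine ⟨MulAut.conj x⁻¹ * φ, fun s hs => ?_, ?_⟩
  · have h := hx (φ s) (Finset.mem_image_of_mem _ (hS.mem_toFinset.2 hs))
    rw [← hd.mul_left x⁻¹, inv_mul_cancel] at h
    simpa [MulAut.mul_apply, mul_assoc] using h
  · have hx : MulAut.conj x⁻¹ ∈ Inn G := ⟨x⁻¹, rfl⟩
    rw [QuotientGroup.mk_mul, (QuotientGroup.eq_one_iff _).2 hx, one_mul]

theorem IsHyperbolic.isOfFinOrder_of_isPointwiseInner (hG : IsHyperbolic G) {φ : MulAut G}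
    (hφ : IsPointwiseInner φ) : IsOfFinOrder (φ : Out G) := by
  refine finite_powers.1 (hG.finite_image_isPointwiseInner.subset ?_)
  rintro _ ⟨n, rfl⟩
  exact ⟨φ ^ n, hφ.pow n, rfl⟩

/-- The automorphisms `φ` such that `π ∘ φ` differs from `π` by conjugation in the target. -/
def conjStabilizer {Q : Type*} [Group Q] (π : G →* Q) : Subgroup (MulAut G) where
  carrier := {φ | ∃ q : Q, ∀ g, π (φ g) = q * π g * q⁻¹}
  one_mem' := ⟨1, by simp⟩
  mul_mem' := by
    rintro φ ψ ⟨q, hq⟩ ⟨r, hr⟩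
    refine ⟨q * r, fun g => ?_⟩
    rw [MulAut.mul_apply, hq, hr]
    group
  inv_mem' := by
    rintro φ ⟨q, hq⟩
    refine ⟨q⁻¹, fun g => ?_⟩
    have h := hq (φ⁻¹ g)
    rw [MulAut.apply_inv_self] at h
    rw [h]
    group

theorem inn_le_conjStabilizer {Q : Type*} [Group Q] (π : G →* Q) : Inn G ≤ conjStabilizer π := by
  rintro _ ⟨x, rfl⟩
  exact ⟨π x, fun g => by simp⟩

/-- The coset of `φ` is determined by `π ∘ φ⁻¹`, one of finitely many homomorphisms from a finitely
generated group to `Q`. -/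
theorem finiteIndex_conjStabilizer {Q : Type*} [Group Q] [Finite Q] {S : Set G} (hS : S.Finite)
    (hgen : Subgroup.closure S = ⊤) (π : G →* Q) : (conjStabilizer π).FiniteIndex := by
  have : Finite S := hS
  have : Finite (G →* Q) := Finite.of_injective _ (injective_restrict_generators hgen)
  have : Finite (MulAut G ⧸ conjStabilizer π) := by
    refine Finite.of_injective (fun x => π.comp (x.out⁻¹ : MulAut G).toMonoidHom) fun x y h => ?_
    rw [← QuotientGroup.out_eq' x, ← QuotientGroup.out_eq' y, QuotientGroup.eq]
    refine ⟨1, fun g => ?_⟩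
    have h' := DFunLike.congr_fun h (y.out g)
    simpa using h'
  exact Subgroup.finiteIndex_of_finite_quotient

/-- In a finitely generated conjugacy separable group, an automorphism which is not pointwise inner
is nontrivial in a finite quotient of the outer automorphism group. -/
theorem IsConjugacySeparable.exists_finiteIndex_notMem (hsep : IsConjugacySeparable G) {S : Set G}
    (hS : S.Finite) (hgen : Subgroup.closure S = ⊤) {φ : MulAut G} (hφ : ¬ IsPointwiseInner φ) :
    ∃ P : Subgroup (Out G), P.FiniteIndex ∧ (φ : Out G) ∉ P := by
  unfold IsPointwiseInner at hφ
  push Not at hφ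
  obtain ⟨g, hg⟩ := hφ
  have h := mt (hsep g (φ g)) hg
  push Not at h
  obtain ⟨N, hN, hfin, hconj⟩ := h
  have : Finite (G ⧸ N) := Subgroup.finite_quotient_of_finiteIndex
  set P := conjStabilizer (QuotientGroup.mk' N)
  have hP : P.FiniteIndex := finiteIndex_conjStabilizer hS hgen _
  have hcomap : (P.map (QuotientGroup.mk' (Inn G))).comap (QuotientGroup.mk' (Inn G)) = P := by
    rw [Subgroup.comap_map_eq, QuotientGroup.ker_mk', sup_eq_left]
    exact inn_le_conjStabilizer _
  refine ⟨P.map (QuotientGroup.mk' (Inn G)), ⟨?_⟩, fun hmem => ?_⟩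
  · rw [← Subgroup.index_comap_of_surjective _ (QuotientGroup.mk'_surjective (Inn G)), hcomap]
    exact hP.index_ne_zero
  · have hφP : φ ∈ P := hcomap ▸ hmem
    obtain ⟨q, hq⟩ := hφP
    exact hconj (isConj_iff.2 ⟨q, (hq g).symm⟩)

end Automorphisms

end HypGroup

theorem theorem2p3 {G : Type*} [Group G] (hhyp : HypGroup.IsHyperbolic G)
    (hsep : HypGroup.IsConjugacySeparable G) (H : Subgroup (HypGroup.Out G))
    (hH : HypGroup.IsVirtuallyTorsionFree H) :
    Group.ResiduallyFinite H := by
  obtain ⟨K, hK, htf⟩ := hH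
  rw [Group.residuallyFinite_iff_exists_finiteIndex]
  intro h hne
  by_cases hhK : h ∈ K
  · obtain ⟨φ, hφ⟩ := QuotientGroup.mk_surjective (h : HypGroup.Out G)
    have hφ' : ¬ HypGroup.IsPointwiseInner φ := fun hpt => by
      have hfin := hhyp.isOfFinOrder_of_isPointwiseInner hpt
      rw [hφ, Submonoid.isOfFinOrder_coe] at hfin
      exact hne (congrArg Subtype.val
        (htf ⟨h, hhK⟩ (Submonoid.isOfFinOrder_coe.1 hfin)))
    obtain ⟨S, hS, -, hgen, -⟩ := hhyp
    obtain ⟨P, hP, hmem⟩ := hsep.exists_finiteIndex_notMem hS hgen hφ'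
    exact ⟨P.subgroupOf H, inferInstance, fun h' => hmem (hφ ▸ Subgroup.mem_subgroupOf.1 h')⟩
  · exact ⟨K, hK, hhK⟩
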